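/- Let $M$ be a smooth ($C^\infty$) manifold of dimension $n$, and let $FM\to M$ be its frame bundle, a principal $GL(n,\mathbb R)$-bundle whose points over $x$ are the linear isomorphisms $\mathbb R^n\to T_xM$, with the right action $X\cdot g=X\circ g$. Local isomorphisms $\Psi$ between frame bundles are diffeomorphisms from a $GL(n,\mathbb R)$-invariant open set onto an open set such that $\Psi(X\cdot g)=\Psi(X)\cdot g$. The second-order non-holonomic frame bundle $\overline F^2M$ is the set of the $1$-jets $j^1_{e_1,\Psi(e_1)}\Psi$ of local isomorphisms $\Psi:F\mathbb R^n\to FM$ defined at $e_1=j^1_{0,0}\mathrm{Id}_{\mathbb R^n}$; it projects to $M$ by sending such a jet to the base point of $\Psi(e_1)$. Let $J^1(FM)$ be the groupoid over $FM$ of the $1$-jets $j^1_{X,Y}\Psi$ of local isomorphisms $\Psi:FM\to FM$ with $\Psi(X)=Y$, and let $\tilde J^1(FM)\rightrightarrows M$ be its quotient Lie groupoid by the action $(j^1_{X,Y}\Psi,g)\mapsto j^1_{X\cdot g,\,Y\cdot g}\Psi$ of $GL(n,\mathbb R)$, with source map $\overline\alpha$ and target map $\overline\beta$. For a smooth section $\overline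 P$ of $\overline F^2M\to M$ put $$\overline{\mathcal G}\,\overline P(x,y)=\big[\overline P(y)\cdot\overline P(x)^{-1}\big]\in\tilde J^1(FM),\qquad x,y\in M .$$ Let $\overline{\mathcal P}:M\times M\to\tilde J^1(FM)$ be a section of $(\overline\alpha,\overline\beta)$, that is, a map (not assumed to be smooth) with $\overline\alpha(\overline{\mathcal P}(x,y))=x$ and $\overline\beta(\overline{\mathcal P}(x,y))=y$ for all $x,y\in M$. Then there is a smooth section $\overline P$ of $\overline F^2M$ with $\overline{\mathcal G}\,\overline P=\overline{\mathcal P}$ if and only if $\overline{\mathcal P}$ is a morphism of Lie groupoids over the identity of $M$ from the pair groupoid $M\times M$ to $\tilde J^1(FM)$, that is, $\overline{\mathcal P}$ is smooth and $\overline{\mathcal P}(y,z)\cdot\overline{\mathcal P}(x,y)=\overline{\mathcal P}(x,z)$ for all $x,y,z\in M$. -/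

import Mathlib

open scoped Manifold ContDiff Bundle Topology
open Bundle

noncomputable section

/-- `ℝⁿ` as a manifold. -/
abbrev Rn (n : ℕ) := EuclideanSpace ℝ (Fin n)

/-- The general linear group `GL(n, ℝ)`, as the group of linear automorphisms of `ℝⁿ`
(the product is composition). -/
abbrev GLn (n : ℕ) := Rn n ≃L[ℝ] Rn n

/-- The total space of the vector bundle `Hom(ℝⁿ, TM)` over `M`. -/
abbrev HomTM (n : ℕ) (M : Type*) [TopologicalSpace M] [ChartedSpace (Rn n) M]
    [IsManifold (𝓡 n) ∞ M] :=
  TotalSpace (Rn n →L[ℝ] Rn n)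
    (fun x : M => Bundle.Trivial M (Rn n) x →L[ℝ] TangentSpace (𝓡 n) x)

/-- The model `ℝⁿ × End(ℝⁿ)` of the manifold `FM`; the induced coordinates are `(xⁱ, xⁱⱼ)`. -/
abbrev modelFM (n : ℕ) := (𝓡 n).prod 𝓘(ℝ, Rn n →L[ℝ] Rn n)

theorem isOpen_setOf_frame (n : ℕ) (M : Type*) [TopologicalSpace M] [ChartedSpace (Rn n) M]
    [IsManifold (𝓡 n) ∞ M] : IsOpen {p : HomTM n M | p.2.IsInvertible} := by
  rw [isOpen_iff_mem_nhds]
  intro p₀ hp₀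
  let e := trivializationAt (Rn n →L[ℝ] Rn n)
    (fun x : M => Bundle.Trivial M (Rn n) x →L[ℝ] TangentSpace (𝓡 n) x) p₀.1
  have hsrc : e.source ∈ 𝓝 p₀ := e.open_source.mem_nhds (by
    rw [e.mem_source]; exact mem_baseSet_trivializationAt _ _ _)
  have key : ∀ p ∈ e.source, ((e p).2.IsInvertible ↔ p.2.IsInvertible) := by
    intro p hp
    rw [hom_trivializationAt_source] at hp
    have h := ContinuousLinearMap.inCoordinates_eq (ϕ := p.2) hp.1 hp.2
    have h2 : (e p).2 = _ := h
    rw [h2]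
    erw [ContinuousLinearMap.isInvertible_equiv_comp, ContinuousLinearMap.isInvertible_comp_equiv]
  have hcont : ContinuousAt (fun p => (e p).2) p₀ :=
    (continuous_snd.continuousAt).comp
      (e.continuousOn.continuousAt hsrc)
  have hopen : {L : Rn n →L[ℝ] Rn n | L.IsInvertible} ∈ 𝓝 (e p₀).2 := by
    have : IsOpen {L : Rn n →L[ℝ] Rn n | L.IsInvertible} :=
      ContinuousLinearEquiv.isOpen (𝕜 := ℝ) (E := Rn n) (F := Rn n)
    exact this.mem_nhds ((key p₀ (mem_of_mem_nhds hsrc)).2 hp₀)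
  filter_upwards [hsrc, hcont hopen] with p h1 h2
  exact (key p h1).1 h2

/-- The open subset of `Hom(ℝⁿ, TM)` that consists of the linear isomorphisms `ℝⁿ → TₓM`. -/
def frameOpens (n : ℕ) (M : Type*) [TopologicalSpace M] [ChartedSpace (Rn n) M]
    [IsManifold (𝓡 n) ∞ M] : TopologicalSpace.Opens (HomTM n M) :=
  ⟨{p | p.2.IsInvertible}, isOpen_setOf_frame n M⟩

/-- The frame bundle `FM`: a frame at `x` is a linear isomorphism `ℝⁿ → TₓM`. Its topology and its
smooth structure are those of an open submanifold of the vector bundle `Hom(ℝⁿ, TM)`. -/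
def FrameBundle (n : ℕ) (M : Type*) [TopologicalSpace M] [ChartedSpace (Rn n) M]
    [IsManifold (𝓡 n) ∞ M] := ↥(frameOpens n M)

section
variable {n : ℕ}
variable {M : Type*} [TopologicalSpace M] [ChartedSpace (Rn n) M] [IsManifold (𝓡 n) ∞ M]
variable {N : Type*} [TopologicalSpace N] [ChartedSpace (Rn n) N] [IsManifold (𝓡 n) ∞ N]
variable {P : Type*} [TopologicalSpace P] [ChartedSpace (Rn n) P] [IsManifold (𝓡 n) ∞ P]

instance : TopologicalSpace (FrameBundle n M) :=
  inferInstanceAs (TopologicalSpace (frameOpens n M))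

instance : ChartedSpace (ModelProd (Rn n) (Rn n →L[ℝ] Rn n)) (FrameBundle n M) :=
  inferInstanceAs (ChartedSpace _ (frameOpens n M))

instance : IsManifold (modelFM n) ∞ (FrameBundle n M) :=
  inferInstanceAs (IsManifold (modelFM n) ∞ (frameOpens n M))

instance : IsManifold (modelFM n) 1 (FrameBundle n M) := IsManifold.of_le (n := ∞) (by simp)

namespace FrameBundle

/-- The projection `FM → M`. -/
def base (X : FrameBundle n M) : M := X.1.1

/-- The linear isomorphism `ℝⁿ → TₓM`. -/
def frame (X : FrameBundle n M) : Rn n →L[ℝ] TangentSpace (𝓡 n) X.base := X.1.2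

/-- The right action of `GL(n, ℝ)` on `FM`: `X · g = X ∘ g`. -/
def act (X : FrameBundle n M) (g : GLn n) : FrameBundle n M :=
  ⟨⟨X.base, X.frame ∘L (g : Rn n →L[ℝ] Rn n)⟩, X.2.comp ⟨g, rfl⟩⟩

theorem base_act (X : FrameBundle n M) (g : GLn n) : (X.act g).base = X.base := rfl

theorem act_one (X : FrameBundle n M) : X.act 1 = X := rfl

theorem act_act (X : FrameBundle n M) (g h : GLn n) : (X.act g).act h = X.act (g * h) := rfl

theorem exists_act_eq (X Y : FrameBundle n M) (h : X.base = Y.base) : ∃ g, X.act g = Y := by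
  obtain ⟨⟨x, u⟩, hu⟩ := X
  obtain ⟨⟨y, v⟩, hv⟩ := Y
  obtain rfl : x = y := h
  obtain ⟨u', hu'⟩ := id hu
  obtain ⟨v', hv'⟩ := id hv
  refine ⟨v'.trans u'.symm, ?_⟩
  apply Subtype.ext
  simp only [act, base, frame]
  congr 1
  change u ∘L ((v'.trans u'.symm : Rn n ≃L[ℝ] Rn n) : Rn n →L[ℝ] Rn n) = v
  change (u' : Rn n →L[ℝ] TangentSpace (𝓡 n) x) = u at hu'
  change (v' : Rn n →L[ℝ] TangentSpace (𝓡 n) x) = v at hv'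
  rw [← hu', ← hv']
  ext1 w
  exact u'.apply_symm_apply (v' w)

theorem contMDiff_act (g : GLn n) :
    ContMDiff (modelFM n) (modelFM n) ∞ (fun X : FrameBundle n M => X.act g) := by
  refine (ContMDiff.subtypeVal_comp_iff (frameOpens n M) _).1 ?_
  have h : ContMDiff (modelFM n) (modelFM n) ∞
      (fun p : HomTM n M => (⟨p.1, p.2 ∘L (g : Rn n →L[ℝ] Rn n)⟩ : HomTM n M)) := by
    intro p
    rw [contMDiffAt_hom_bundle]
    have h0 := (contMDiffAt_hom_bundle (IB := 𝓡 n) (IM := modelFM n) (n := ∞)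
      (fun p : HomTM n M => p) (x₀ := p)).1 contMDiffAt_id
    refine ⟨h0.1, ?_⟩
    have h1 := h0.2
    refine (h1.clm_comp (contMDiffAt_const (c := (g : Rn n →L[ℝ] Rn n)))).congr_of_eventuallyEq ?_
    filter_upwards with q
    ext v
    simp [ContinuousLinearMap.inCoordinates]
  exact h.comp contMDiff_subtype_val

/-- The frame of `ℝⁿ` at `0` that is the `1`-jet of the identity. -/
def e₁ (n : ℕ) : FrameBundle n (Rn n) :=
  ⟨⟨0, ContinuousLinearMap.id ℝ (Rn n)⟩, ⟨ContinuousLinearEquiv.refl ℝ (Rn n), rfl⟩⟩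

end FrameBundle

variable (n M N) in
/-- Local isomorphisms of principal bundles `FM → FN` over the identity of `GL(n, ℝ)`:
diffeomorphisms from a `GL(n, ℝ)`-invariant open set (that is, from `FU` with `U ⊆ M` open) onto an
open set, which commute with the action of `GL(n, ℝ)`. -/
structure LocalFrameIso extends OpenPartialHomeomorph (FrameBundle n M) (FrameBundle n N) where
  act_mem_source : ∀ (X : FrameBundle n M) (g : GLn n), X ∈ source → X.act g ∈ source
  map_act : ∀ (X : FrameBundle n M) (g : GLn n), X ∈ source →
    toFun (X.act g) = FrameBundle.act (toFun X) g
  contMDiffOn_toFun : ContMDiffOn (modelFM n) (modelFM n) ∞ toFun source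
  contMDiffOn_invFun : ContMDiffOn (modelFM n) (modelFM n) ∞ invFun target

namespace LocalFrameIso

def refl : LocalFrameIso n M M where
  toOpenPartialHomeomorph := OpenPartialHomeomorph.refl _
  act_mem_source _ _ _ := trivial
  map_act _ _ _ := rfl
  contMDiffOn_toFun := contMDiffOn_id
  contMDiffOn_invFun := contMDiffOn_id

theorem symm_act (Ψ : LocalFrameIso n M N) (Y : FrameBundle n N) (g : GLn n)
    (hY : Y ∈ Ψ.target) : Y.act g ∈ Ψ.target ∧
      Ψ.toOpenPartialHomeomorph.symm (Y.act g) =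
        FrameBundle.act (Ψ.toOpenPartialHomeomorph.symm Y) g := by
  have h1 := Ψ.act_mem_source _ g (Ψ.map_target hY)
  have h2 : Ψ.toOpenPartialHomeomorph
      (FrameBundle.act (Ψ.toOpenPartialHomeomorph.symm Y) g) = Y.act g := by
    have := Ψ.map_act _ g (Ψ.map_target hY)
    refine this.trans ?_
    exact congrArg (fun Z => FrameBundle.act Z g) (Ψ.right_inv hY)
  refine ⟨h2 ▸ Ψ.map_source h1, ?_⟩
  rw [← h2]
  exact Ψ.left_inv h1

def symm (Ψ : LocalFrameIso n M N) : LocalFrameIso n N M where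
  toOpenPartialHomeomorph := Ψ.toOpenPartialHomeomorph.symm
  act_mem_source Y g hY := (Ψ.symm_act Y g hY).1
  map_act Y g hY := (Ψ.symm_act Y g hY).2
  contMDiffOn_toFun := Ψ.contMDiffOn_invFun
  contMDiffOn_invFun := Ψ.contMDiffOn_toFun

def trans (Ψ : LocalFrameIso n M N) (Φ : LocalFrameIso n N P) : LocalFrameIso n M P where
  toOpenPartialHomeomorph := Ψ.toOpenPartialHomeomorph.trans Φ.toOpenPartialHomeomorph
  act_mem_source X g hX := by
    refine ⟨Ψ.act_mem_source X g hX.1, ?_⟩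
    have h : Ψ.toOpenPartialHomeomorph (X.act g) = _ := Ψ.map_act X g hX.1
    change Ψ.toOpenPartialHomeomorph (X.act g) ∈ Φ.source
    rw [h]
    exact Φ.act_mem_source _ g hX.2
  map_act X g hX :=
    (congrArg Φ.toOpenPartialHomeomorph (Ψ.map_act X g hX.1)).trans (Φ.map_act _ g hX.2)
  contMDiffOn_toFun := Φ.contMDiffOn_toFun.comp (Ψ.contMDiffOn_toFun.mono fun _ h => h.1)
    fun _ h => h.2
  contMDiffOn_invFun := Ψ.contMDiffOn_invFun.comp (Φ.contMDiffOn_invFun.mono fun _ h => h.1)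
    fun _ h => h.2

instance : CoeFun (LocalFrameIso n M N) (fun _ => FrameBundle n M → FrameBundle n N) :=
  ⟨fun Ψ => Ψ.toOpenPartialHomeomorph⟩

theorem mdifferentiableAt (Ψ : LocalFrameIso n M N) {X : FrameBundle n M} (hX : X ∈ Ψ.source) :
    MDifferentiableAt (modelFM n) (modelFM n) Ψ X :=
  (Ψ.contMDiffOn_toFun.contMDiffAt (Ψ.open_source.mem_nhds hX)).mdifferentiableAt (by simp)

end LocalFrameIso

variable (n M N) in
/-- Triples `(X, Y, L)` with `X ∈ FM`, `Y ∈ FN` and `L : T_X FM → T_Y FN` linear: a `1`-jet of a map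
from `FM` to `FN` is given by its source, its target and its tangent map at the source. -/
structure PreJet where
  src : FrameBundle n M
  tgt : FrameBundle n N
  deriv : TangentSpace (modelFM n) src →L[ℝ] TangentSpace (modelFM n) tgt

namespace PreJet

/-- Composition of `1`-jets. -/
def comp (b : PreJet n N P) (a : PreJet n M N) (h : a.tgt = b.src) : PreJet n M P :=
  ⟨a.src, b.tgt, b.deriv ∘L
    (show TangentSpace (modelFM n) a.src →L[ℝ] TangentSpace (modelFM n) b.src from
      h ▸ a.deriv)⟩

/-- The inverse of a `1`-jet (used only when the tangent map is invertible). -/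
def inv (a : PreJet n M N) : PreJet n N M := ⟨a.tgt, a.src, a.deriv.inverse⟩

end PreJet

/-- The `1`-jet at `X` of a local isomorphism `Ψ`, for `X` in the domain of `Ψ`. -/
def LocalFrameIso.jetAt (Ψ : LocalFrameIso n M N) (X : FrameBundle n M) : PreJet n M N :=
  ⟨X, Ψ X, mfderiv (modelFM n) (modelFM n) Ψ X⟩

theorem LocalFrameIso.jetAt_trans (Ψ : LocalFrameIso n M N) (Φ : LocalFrameIso n N P)
    {X : FrameBundle n M} (hX : X ∈ Ψ.source) (hY : Ψ X ∈ Φ.source) :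
    (Ψ.trans Φ).jetAt X = (Φ.jetAt (Ψ X)).comp (Ψ.jetAt X) rfl := by
  have := mfderiv_comp X (Φ.mdifferentiableAt hY) (Ψ.mdifferentiableAt hX)
  simp only [jetAt, PreJet.comp]
  exact congrArg (PreJet.mk X (Φ (Ψ X))) this

theorem PreJet.ext_of {a b : PreJet n M N} (h₁ : a.src = b.src) (h₂ : a.tgt = b.tgt)
    (h₃ : @Eq (TangentSpace (modelFM n) a.src →L[ℝ] TangentSpace (modelFM n) a.tgt)
      a.deriv b.deriv) : a = b := by
  obtain ⟨X, Y, L⟩ := a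
  obtain ⟨X', Y', L'⟩ := b
  obtain rfl : X = X' := h₁
  obtain rfl : Y = Y' := h₂
  exact congrArg _ h₃

theorem LocalFrameIso.deriv_symm_comp (Ψ : LocalFrameIso n M N)
    {X : FrameBundle n M} (hX : X ∈ Ψ.source) :
    (mfderiv (modelFM n) (modelFM n) Ψ.symm (Ψ X)) ∘L (mfderiv (modelFM n) (modelFM n) Ψ X) =
      ContinuousLinearMap.id ℝ (TangentSpace (modelFM n) X) := by
  have h1 := mfderiv_comp X (Ψ.symm.mdifferentiableAt (X := Ψ X) (Ψ.map_source hX))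
    (Ψ.mdifferentiableAt hX)
  rw [← mfderiv_id, ← h1]
  apply Filter.EventuallyEq.mfderiv_eq
  filter_upwards [Ψ.open_source.mem_nhds hX] with Z hZ
  exact Ψ.left_inv hZ

theorem LocalFrameIso.jetAt_symm (Ψ : LocalFrameIso n M N)
    {X : FrameBundle n M} (hX : X ∈ Ψ.source) :
    Ψ.symm.jetAt (Ψ X) = (Ψ.jetAt X).inv := by
  have hX' : Ψ.symm (Ψ X) = X := Ψ.left_inv hX
  refine PreJet.ext_of rfl hX' ?_
  have h1 := Ψ.deriv_symm_comp hX
  have h2 := Ψ.symm.deriv_symm_comp (X := Ψ X) (Ψ.map_source hX)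
  rw [hX'] at h2
  exact (ContinuousLinearMap.inverse_eq h2 h1).symm

theorem LocalFrameIso.src_jetAt (Ψ : LocalFrameIso n M N) (X : FrameBundle n M) :
    (Ψ.jetAt X).src = X := rfl

theorem FrameBundle.mdifferentiableAt_act (g : GLn n) (X : FrameBundle n M) :
    MDifferentiableAt (modelFM n) (modelFM n) (fun W : FrameBundle n M => W.act g) X :=
  (FrameBundle.contMDiff_act g).contMDiffAt.mdifferentiableAt (by simp)

theorem FrameBundle.act_act_inv (X : FrameBundle n M) (g : GLn n) : (X.act g).act g⁻¹ = X := by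
  rw [FrameBundle.act_act, mul_inv_cancel, FrameBundle.act_one]

abbrev modelTFM (n : ℕ) := Rn n × (Rn n →L[ℝ] Rn n)

theorem mfderiv_conj_congr {E H A B C D : Type*} [NormedAddCommGroup E] [NormedSpace ℝ E]
    [TopologicalSpace H] {I : ModelWithCorners ℝ E H}
    [TopologicalSpace A] [ChartedSpace H A] [TopologicalSpace B] [ChartedSpace H B]
    [TopologicalSpace C] [ChartedSpace H C] [TopologicalSpace D] [ChartedSpace H D]
    {u : A → B} {f₁ f₂ : B → C} {v : C → D} {a : A} {b : B} (hb : u a = b)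
    (hu : MDifferentiableAt I I u a) (h₁ : MDifferentiableAt I I f₁ b)
    (h₂ : MDifferentiableAt I I f₂ b) (hv : MDifferentiableAt I I v (f₁ b))
    (h₀ : f₁ b = f₂ b) (h : @Eq (E →L[ℝ] E) (mfderiv I I f₁ b) (mfderiv I I f₂ b)) :
    @Eq (E →L[ℝ] E) (mfderiv I I (v ∘ f₁ ∘ u) a) (mfderiv I I (v ∘ f₂ ∘ u) a) := by
  subst hb
  have e₁ := mfderiv_comp a hv (h₁.comp a hu)
  have e₂ := mfderiv_comp a (show MDifferentiableAt I I v (f₂ (u a)) from h₀ ▸ hv) (h₂.comp a hu)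
  rw [mfderiv_comp a h₁ hu] at e₁
  rw [mfderiv_comp a h₂ hu] at e₂
  refine e₁.trans (Eq.trans ?_ e₂.symm)
  have e₃ : @Eq (E →L[ℝ] E) (mfderiv I I v (f₁ (u a))) (mfderiv I I v (f₂ (u a))) := by rw [h₀]
  exact congrArg₂ (fun K L : E →L[ℝ] E => K ∘L L ∘L (mfderiv I I u a : E →L[ℝ] E)) e₃ h

theorem LocalFrameIso.eventuallyEq_conj (Θ : LocalFrameIso n M N) {X : FrameBundle n M}
    (hX : X ∈ Θ.source) (g : GLn n) :
    (Θ : FrameBundle n M → FrameBundle n N) =ᶠ[𝓝 (X.act g)]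
      (fun W : FrameBundle n N => W.act g) ∘ Θ ∘ (fun W : FrameBundle n M => W.act g⁻¹) := by
  filter_upwards [Θ.open_source.mem_nhds (Θ.act_mem_source X g hX)] with Z hZ
  change Θ Z = (Θ (Z.act g⁻¹)).act g
  have h1 : Θ (Z.act g⁻¹) = (Θ Z).act g⁻¹ := Θ.map_act Z g⁻¹ hZ
  rw [h1, FrameBundle.act_act, inv_mul_cancel, FrameBundle.act_one]

/-- The `1`-jet at `X · g` is determined by the `1`-jet at `X`. -/
theorem LocalFrameIso.jetAt_act_congr {Ψ Φ : LocalFrameIso n M N} {X : FrameBundle n M}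
    (hΨ : X ∈ Ψ.source) (hΦ : X ∈ Φ.source) (h : Ψ.jetAt X = Φ.jetAt X) (g : GLn n) :
    Ψ.jetAt (X.act g) = Φ.jetAt (X.act g) := by
  have h1 : Ψ X = Φ X := congrArg PreJet.tgt h
  have h2 : @Eq (modelTFM n →L[ℝ] modelTFM n) (mfderiv (modelFM n) (modelFM n) Ψ X)
    (mfderiv (modelFM n) (modelFM n) Φ X) :=
    congrArg (fun a : PreJet n M N => (show modelTFM n →L[ℝ] modelTFM n from a.deriv)) h
  refine PreJet.ext_of rfl ?_ ?_
  · change Ψ (X.act g) = Φ (X.act g)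
    have hΨ' : Ψ (X.act g) = _ := Ψ.map_act X g hΨ
    have hΦ' : Φ (X.act g) = _ := Φ.map_act X g hΦ
    rw [hΨ', hΦ']
    exact congrArg (fun Z => FrameBundle.act Z g) h1
  · have e₁ := (Ψ.eventuallyEq_conj hΨ g).mfderiv_eq (I := modelFM n) (I' := modelFM n)
    have e₂ := (Φ.eventuallyEq_conj hΦ g).mfderiv_eq (I := modelFM n) (I' := modelFM n)
    have e₃ := mfderiv_conj_congr (u := fun W : FrameBundle n M => W.act g⁻¹)
      (v := fun W : FrameBundle n N => W.act g) (X.act_act_inv g) (FrameBundle.mdifferentiableAt_act g⁻¹ (X.act g))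
      (Ψ.mdifferentiableAt hΨ) (Φ.mdifferentiableAt hΦ)
      (FrameBundle.mdifferentiableAt_act g (Ψ X)) h1 h2
    exact Eq.trans e₁ (Eq.trans e₃ e₂.symm)

variable (n M N) in
/-- The set of the `1`-jets `j¹_{X, Ψ(X)} Ψ` of local isomorphisms `Ψ` from `FM` to `FN` over the
identity of `GL(n, ℝ)`. For `M = N` this is `J¹(FM)`. -/
def Jet := {a : PreJet n M N //
  ∃ Ψ : LocalFrameIso n M N, a.src ∈ Ψ.source ∧ Ψ.jetAt a.src = a}

namespace Jet

def src (a : Jet n M N) : FrameBundle n M := a.1.src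

def tgt (a : Jet n M N) : FrameBundle n N := a.1.tgt

/-- The `1`-jet of `Ψ` at `X`. -/
def of (Ψ : LocalFrameIso n M N) (X : FrameBundle n M) (hX : X ∈ Ψ.source) : Jet n M N :=
  ⟨Ψ.jetAt X, Ψ, hX, rfl⟩

def comp (b : Jet n N P) (a : Jet n M N) (h : a.tgt = b.src) : Jet n M P :=
  ⟨b.1.comp a.1 h, by
    obtain ⟨a, Ψ, hX, ha⟩ := a
    obtain ⟨b, Φ, hY, hb⟩ := b
    obtain ⟨X, Y, L⟩ := a
    obtain ⟨Y', Z, L'⟩ := b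
    obtain rfl : Y = Y' := h
    have hY' : Ψ X = Y := congrArg PreJet.tgt ha
    subst hY'
    refine ⟨Ψ.trans Φ, ⟨hX, hY⟩, ?_⟩
    refine (Ψ.jetAt_trans Φ hX hY).trans ?_
    have ha' : Ψ.jetAt X = ⟨X, Ψ X, L⟩ := ha
    have hb' : Φ.jetAt (Ψ X) = ⟨Ψ X, Z, L'⟩ := hb
    congr 1⟩

def inv (a : Jet n M N) : Jet n N M :=
  ⟨a.1.inv, by
    obtain ⟨a, Ψ, hX, ha⟩ := a
    have hY : Ψ a.src = a.tgt := congrArg PreJet.tgt ha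
    refine ⟨Ψ.symm, ?_, ?_⟩
    · change a.tgt ∈ Ψ.target
      rw [← hY]
      exact Ψ.map_source hX
    · change Ψ.symm.jetAt a.tgt = a.inv
      rw [← hY, Ψ.jetAt_symm hX, ha]⟩

theorem exists_of (a : Jet n M N) : ∃ Ψ X hX, a = of Ψ X hX := by
  obtain ⟨a, Ψ, hX, ha⟩ := a
  exact ⟨Ψ, a.src, hX, Subtype.ext ha.symm⟩

theorem of_comp_of (Ψ : LocalFrameIso n M N) (Φ : LocalFrameIso n N P) {X : FrameBundle n M}
    (hX : X ∈ Ψ.source) (hY : Ψ X ∈ Φ.source) :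
    (of Φ (Ψ X) hY).comp (of Ψ X hX) rfl = of (Ψ.trans Φ) X ⟨hX, hY⟩ :=
  Subtype.ext (Ψ.jetAt_trans Φ hX hY).symm

theorem inv_of (Ψ : LocalFrameIso n M N) {X : FrameBundle n M} (hX : X ∈ Ψ.source) :
    (of Ψ X hX).inv = of Ψ.symm (Ψ X) (Ψ.map_source hX) :=
  Subtype.ext (Ψ.jetAt_symm hX).symm

theorem of_congr {Ψ Φ : LocalFrameIso n M N} {X Y : FrameBundle n M}
    {hX : X ∈ Ψ.source} {hY : Y ∈ Φ.source} (h : of Ψ X hX = of Φ Y hY) (g : GLn n) :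
    of Ψ (X.act g) (Ψ.act_mem_source X g hX) = of Φ (Y.act g) (Φ.act_mem_source Y g hY) := by
  have h1 : Ψ.jetAt X = Φ.jetAt Y := congrArg Subtype.val h
  obtain rfl : X = Y := congrArg PreJet.src h1
  exact Subtype.ext (LocalFrameIso.jetAt_act_congr hX hY h1 g)

variable (n M) in
/-- The orbit relation on `J¹(FM)` of the right action of `GL(n, ℝ)` by
`j¹_{X, Y} Ψ · g = j¹_{X · g, Y · g} Ψ`. -/
def orbitSetoid : Setoid (Jet n M M) where
  r a b := ∃ (Ψ : LocalFrameIso n M M) (X : FrameBundle n M) (hX : X ∈ Ψ.source) (g : GLn n),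
    a = of Ψ X hX ∧ b = of Ψ (X.act g) (Ψ.act_mem_source X g hX)
  iseqv := by
    refine ⟨fun a => ?_, ?_, ?_⟩
    · obtain ⟨Ψ, X, hX, rfl⟩ := a.exists_of
      exact ⟨Ψ, X, hX, 1, rfl, rfl⟩
    · rintro a b ⟨Ψ, X, hX, g, rfl, rfl⟩
      refine ⟨Ψ, X.act g, Ψ.act_mem_source X g hX, g⁻¹, rfl, ?_⟩
      congr 1
      exact (X.act_act_inv g).symm
    · rintro a b c ⟨Ψ, X, hX, g, rfl, rfl⟩ ⟨Φ, Y, hY, k, h, rfl⟩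
      refine ⟨Ψ, X, hX, g * k, rfl, ?_⟩
      exact (of_congr h k).symm

end Jet

variable (n M) in
/-- The second-order non-holonomic groupoid: the quotient of `J¹(FM)` by the action of
`GL(n, ℝ)`. -/
def JTilde := Quotient (Jet.orbitSetoid n M)

namespace JTilde

/-- The class of a `1`-jet. -/
def mk (a : Jet n M M) : JTilde n M := Quotient.mk (Jet.orbitSetoid n M) a

/-- The source map: the class of `j¹_{X, Y} Ψ` is sent to the base point of `X`. -/
def src : JTilde n M → M :=
  Quotient.lift (fun a : Jet n M M => a.src.base) (by
    rintro a b ⟨Ψ, X, hX, g, rfl, rfl⟩; rfl)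

/-- The target map: the class of `j¹_{X, Y} Ψ` is sent to the base point of `Y`. -/
def tgt : JTilde n M → M :=
  Quotient.lift (fun a : Jet n M M => a.tgt.base) (by
    rintro a b ⟨Ψ, X, hX, g, rfl, rfl⟩
    exact (congrArg FrameBundle.base (Ψ.map_act X g hX)).symm)

theorem mk_of_act (Ψ : LocalFrameIso n M M) (X : FrameBundle n M) (hX : X ∈ Ψ.source)
    (g : GLn n) : mk (Jet.of Ψ (X.act g) (Ψ.act_mem_source X g hX)) = mk (Jet.of Ψ X hX) :=
  (Quotient.sound (s := Jet.orbitSetoid n M) ⟨Ψ, X, hX, g, rfl, rfl⟩).symm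

theorem exists_of (q : JTilde n M) (X : FrameBundle n M) (h : X.base = q.src) :
    ∃ Ψ hX, q = mk (Jet.of Ψ X hX) := by
  obtain ⟨a, rfl⟩ := Quotient.exists_rep q
  obtain ⟨Ψ, Y, hY, rfl⟩ := a.exists_of
  obtain ⟨g, rfl⟩ := FrameBundle.exists_act_eq Y X h.symm
  exact ⟨Ψ, Ψ.act_mem_source Y g hY, (mk_of_act Ψ Y hY g).symm⟩

theorem mk_eq_mk {a b : Jet n M M} (h : mk a = mk b) (hs : a.src = b.src) : a = b := by
  obtain ⟨Ψ, X, hX, g, rfl, rfl⟩ : (Jet.orbitSetoid n M).r a b := Quotient.exact h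
  have hs' : X = X.act g := hs
  congr 1

theorem exists_src (x : M) : ∃ X : FrameBundle n M, X.base = x :=
  ⟨⟨⟨x, ContinuousLinearMap.id ℝ (Rn n)⟩, ContinuousLinearEquiv.refl ℝ (Rn n), rfl⟩, rfl⟩

/-- The class of the composite of composable representatives exists and does not depend on the
representatives. -/
theorem existsUnique_mul (q p : JTilde n M) (h : q.src = p.tgt) :
    ∃! r : JTilde n M, ∃ (b a : Jet n M M) (hab : a.tgt = b.src),
      mk b = q ∧ mk a = p ∧ mk (b.comp a hab) = r := by
  obtain ⟨X, hX⟩ := exists_src (n := n) p.src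
  obtain ⟨Ψ, hΨ, rfl⟩ := p.exists_of X hX
  obtain ⟨Φ, hΦ, rfl⟩ := q.exists_of (Ψ X) h.symm
  refine ⟨_, ⟨_, _, rfl, rfl, rfl, rfl⟩, ?_⟩
  rintro r ⟨b, a, hab, hb, ha, rfl⟩
  obtain ⟨Ψ', X', hX', rfl⟩ := a.exists_of
  obtain ⟨Φ', Y', hY', rfl⟩ := b.exists_of
  obtain rfl : Ψ' X' = Y' := hab
  obtain ⟨g, rfl⟩ := FrameBundle.exists_act_eq X' X ((congrArg src ha).trans hX.symm)
  rw [Jet.of_comp_of, Jet.of_comp_of]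
  rw [← mk_of_act (Ψ'.trans Φ') X' ⟨hX', hY'⟩ g]
  have ha' := mk_eq_mk ((mk_of_act Ψ' X' hX' g).trans ha) rfl
  have e1 : Ψ' (X'.act g) = (Ψ' X').act g := Ψ'.map_act X' g hX'
  have e2 : Ψ' (X'.act g) = Ψ (X'.act g) := congrArg Jet.tgt ha'
  have hb' := mk_eq_mk ((mk_of_act Φ' _ hY' g).trans hb) (e1.symm.trans e2)
  have hY2 : Ψ' (X'.act g) ∈ Φ'.source := e1 ▸ Φ'.act_mem_source _ g hY'
  rw [← Jet.of_comp_of _ _ (Ψ'.act_mem_source X' g hX') hY2,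
    ← Jet.of_comp_of Ψ Φ hΨ hΦ]
  have hb2 : Jet.of Φ' (Ψ' (X'.act g)) hY2 = Jet.of Φ (Ψ (X'.act g)) hΦ := by
    rw [← hb']; congr 1
  congr 1
  congr 1

/-- The product `q · p`: the class of `b ∘ a`, for any composable representatives `b` of `q` and
`a` of `p`. -/
def mul (q p : JTilde n M) (h : q.src = p.tgt) : JTilde n M :=
  (existsUnique_mul q p h).choose

theorem mul_mk (b a : Jet n M M) (h : a.tgt = b.src) (h' : (mk b).src = (mk a).tgt) :
    mul (mk b) (mk a) h' = mk (b.comp a h) :=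
  ((existsUnique_mul (mk b) (mk a) h').choose_spec.2 _ ⟨b, a, h, rfl, rfl, rfl⟩).symm

theorem mul_eq {q p : JTilde n M} (b a : Jet n M M) (hq : q = mk b) (hp : p = mk a)
    (hab : a.tgt = b.src) (h : q.src = p.tgt) : mul q p h = mk (b.comp a hab) := by
  subst hq hp
  exact mul_mk b a hab h

/-- The identities: the class of the `1`-jet of the identity at a frame at `x`. -/
def unit (x : M) : JTilde n M :=
  mk (Jet.of LocalFrameIso.refl
    ⟨⟨x, ContinuousLinearMap.id ℝ (Rn n)⟩, ContinuousLinearEquiv.refl ℝ (Rn n), rfl⟩ trivial)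

theorem unit_eq (X : FrameBundle n M) (x : M) (h : X.base = x) :
    unit x = mk (Jet.of LocalFrameIso.refl X trivial) := by
  obtain ⟨g, rfl⟩ := FrameBundle.exists_act_eq
    ⟨⟨x, ContinuousLinearMap.id ℝ (Rn n)⟩, ContinuousLinearEquiv.refl ℝ (Rn n), rfl⟩ X h.symm
  exact (mk_of_act _ _ _ g).symm

/-- The inverse: the class of the inverse jet. -/
def inv : JTilde n M → JTilde n M :=
  Quotient.lift (fun a : Jet n M M => mk a.inv) (by
    rintro a b ⟨Ψ, X, hX, g, rfl, rfl⟩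
    simp only [Jet.inv_of]
    rw [← mk_of_act Ψ.symm (Ψ X) (Ψ.map_source hX) g]
    congr 2
    exact (Ψ.map_act X g hX).symm)

end JTilde

/-- A groupoid `Γ ⇉ B`. The product `g · h` is defined when `src g = tgt h`. -/
structure GroupoidOver (Γ B : Type*) where
  src : Γ → B
  tgt : Γ → B
  unit : B → Γ
  inv : Γ → Γ
  mul : ∀ g h : Γ, src g = tgt h → Γ
  src_unit : ∀ x, src (unit x) = x
  tgt_unit : ∀ x, tgt (unit x) = x
  src_inv : ∀ g, src (inv g) = tgt g
  tgt_inv : ∀ g, tgt (inv g) = src g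
  src_mul : ∀ g h p, src (mul g h p) = src h
  tgt_mul : ∀ g h p, tgt (mul g h p) = tgt g
  mul_assoc : ∀ g h k (p : src g = tgt h) (q : src h = tgt k),
    mul g (mul h k q) (p.trans (tgt_mul h k q).symm) = mul (mul g h p) k ((src_mul g h p).trans q)
  mul_unit : ∀ g, mul g (unit (src g)) (tgt_unit (src g)).symm = g
  unit_mul : ∀ g, mul (unit (tgt g)) g (src_unit (tgt g)) = g
  inv_mul : ∀ g, mul (inv g) g (src_inv g) = unit (src g)
  mul_inv : ∀ g, mul g (inv g) (tgt_inv g).symm = unit (tgt g)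

/-- The pair groupoid on `B`, with `(y, z) · (x, y) = (x, z)`. -/
def pairGroupoid (B : Type*) : GroupoidOver (B × B) B where
  src g := g.1
  tgt g := g.2
  unit x := (x, x)
  inv g := (g.2, g.1)
  mul g h _ := (h.1, g.2)
  src_unit _ := rfl
  tgt_unit _ := rfl
  src_inv _ := rfl
  tgt_inv _ := rfl
  src_mul _ _ _ := rfl
  tgt_mul _ _ _ := rfl
  mul_assoc _ _ _ _ _ := rfl
  mul_unit _ := rfl
  unit_mul _ := rfl
  inv_mul _ := rfl
  mul_inv _ := rfl

/-- Morphisms of groupoids. -/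
structure IsGroupoidHom {Γ₁ B₁ Γ₂ B₂ : Type*} (G₁ : GroupoidOver Γ₁ B₁) (G₂ : GroupoidOver Γ₂ B₂)
    (F : Γ₁ → Γ₂) (f : B₁ → B₂) : Prop where
  src_map : ∀ g, G₂.src (F g) = f (G₁.src g)
  tgt_map : ∀ g, G₂.tgt (F g) = f (G₁.tgt g)
  map_mul : ∀ g h (p : G₁.src g = G₁.tgt h),
    F (G₁.mul g h p) = G₂.mul (F g) (F h)
      ((src_map g).trans ((congrArg f p).trans (tgt_map h).symm))

namespace JTilde

theorem src_mul (q p : JTilde n M) (h : q.src = p.tgt) : (mul q p h).src = p.src := by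
  obtain ⟨b, a, hab, rfl, rfl, h3⟩ := (existsUnique_mul q p h).choose_spec.1
  exact (congrArg src h3).symm

theorem tgt_mul (q p : JTilde n M) (h : q.src = p.tgt) : (mul q p h).tgt = q.tgt := by
  obtain ⟨b, a, hab, rfl, rfl, h3⟩ := (existsUnique_mul q p h).choose_spec.1
  exact (congrArg tgt h3).symm

theorem src_inv (q : JTilde n M) : q.inv.src = q.tgt := by
  obtain ⟨a, rfl⟩ := Quotient.exists_rep q; rfl

theorem tgt_inv (q : JTilde n M) : q.inv.tgt = q.src := by
  obtain ⟨a, rfl⟩ := Quotient.exists_rep q; rfl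

theorem mk_of_congr {Ψ Φ : LocalFrameIso n M M} {X : FrameBundle n M} (hX : X ∈ Ψ.source)
    (hX' : X ∈ Φ.source) (h : (Ψ : FrameBundle n M → FrameBundle n M) =ᶠ[𝓝 X] Φ) :
    Jet.of Ψ X hX = Jet.of Φ X hX' :=
  Subtype.ext (PreJet.ext_of rfl h.eq_of_nhds h.mfderiv_eq)

variable (n M) in
/-- The groupoid structure on `J̃¹(FM)`. -/
def groupoid : GroupoidOver (JTilde n M) M where
  src := src
  tgt := tgt
  unit := unit
  inv := inv
  mul := mul
  src_unit _ := rfl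
  tgt_unit _ := rfl
  src_inv := src_inv
  tgt_inv := tgt_inv
  src_mul := src_mul
  tgt_mul := tgt_mul
  mul_assoc r q p h₁ h₂ := by
    obtain ⟨X, hX⟩ := exists_src (n := n) p.src
    obtain ⟨Ψ, hΨ, rfl⟩ := p.exists_of X hX
    obtain ⟨Φ, hΦ, rfl⟩ := q.exists_of (Ψ X) h₂.symm
    obtain ⟨Θ, hΘ, rfl⟩ := r.exists_of (Φ (Ψ X)) h₁.symm
    have e1 := mul_mk (Jet.of Φ (Ψ X) hΦ) (Jet.of Ψ X hΨ) rfl h₂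
    have e2 := mul_mk (Jet.of Θ (Φ (Ψ X)) hΘ) (Jet.of Φ (Ψ X) hΦ) rfl h₁
    rw [Jet.of_comp_of] at e1 e2
    simp only [e1, e2]
    rw [mul_mk (Jet.of Θ (Φ (Ψ X)) hΘ) (Jet.of (Ψ.trans Φ) X ⟨hΨ, hΦ⟩) rfl,
      mul_mk (Jet.of (Φ.trans Θ) (Ψ X) ⟨hΦ, hΘ⟩) (Jet.of Ψ X hΨ) rfl]
    have e3 := Jet.of_comp_of (Ψ.trans Φ) Θ (X := X) ⟨hΨ, hΦ⟩ hΘ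
    have e4 := Jet.of_comp_of Ψ (Φ.trans Θ) hΨ ⟨hΦ, hΘ⟩
    rw [e4]
    refine (congrArg mk e3).trans (congrArg mk ?_)
    exact mk_of_congr _ _ Filter.EventuallyEq.rfl
  mul_unit p := by
    obtain ⟨X, hX⟩ := exists_src (n := n) p.src
    obtain ⟨Ψ, hΨ, rfl⟩ := p.exists_of X hX
    rw [mul_eq (Jet.of Ψ X hΨ) (Jet.of LocalFrameIso.refl X trivial) rfl (unit_eq X _ hX) rfl]
    have e := Jet.of_comp_of LocalFrameIso.refl Ψ (X := X) trivial hΨ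
    refine (congrArg mk e).trans (congrArg mk ?_)
    exact mk_of_congr _ _ Filter.EventuallyEq.rfl
  unit_mul p := by
    obtain ⟨X, hX⟩ := exists_src (n := n) p.src
    obtain ⟨Ψ, hΨ, rfl⟩ := p.exists_of X hX
    refine (mul_eq (Jet.of LocalFrameIso.refl (Ψ X) trivial) (Jet.of Ψ X hΨ)
      (unit_eq (Ψ X) _ rfl) rfl rfl _).trans ?_
    have e := Jet.of_comp_of Ψ LocalFrameIso.refl (X := X) hΨ trivial
    refine (congrArg mk e).trans (congrArg mk ?_)
    exact mk_of_congr _ _ Filter.EventuallyEq.rfl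
  inv_mul p := by
    obtain ⟨X, hX⟩ := exists_src (n := n) p.src
    obtain ⟨Ψ, hΨ, rfl⟩ := p.exists_of X hX
    have e := Jet.of_comp_of Ψ Ψ.symm hΨ (Ψ.map_source hΨ)
    refine (mul_eq (Jet.of Ψ.symm (Ψ X) (Ψ.map_source hΨ)) (Jet.of Ψ X hΨ)
      (congrArg mk (Jet.inv_of Ψ hΨ)) rfl rfl _).trans ?_
    refine Eq.trans (congrArg mk e) (Eq.trans (congrArg mk ?_) (unit_eq X _ hX).symm)
    refine mk_of_congr _ _ ?_
    filter_upwards [Ψ.open_source.mem_nhds hΨ] with Z hZ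
    exact Ψ.left_inv hZ
  mul_inv p := by
    obtain ⟨X, hX⟩ := exists_src (n := n) p.src
    obtain ⟨Ψ, hΨ, rfl⟩ := p.exists_of X hX
    have hX' : Ψ.symm (Ψ X) = X := Ψ.left_inv hΨ
    have hs : Ψ.symm (Ψ X) ∈ Ψ.source := by rwa [hX']
    have e1 : Jet.of Ψ X hΨ = Jet.of Ψ (Ψ.symm (Ψ X)) hs := by congr 1; exact hX'.symm
    have e := Jet.of_comp_of Ψ.symm Ψ (X := Ψ X) (Ψ.map_source hΨ) hs
    refine (mul_eq (Jet.of Ψ (Ψ.symm (Ψ X)) hs) (Jet.of Ψ.symm (Ψ X) (Ψ.map_source hΨ))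
      (congrArg mk e1) (congrArg mk (Jet.inv_of Ψ hΨ)) rfl _).trans ?_
    refine Eq.trans (congrArg mk e) (Eq.trans (congrArg mk ?_) (unit_eq (Ψ X) _ rfl).symm)
    refine mk_of_congr _ _ ?_
    filter_upwards [Ψ.open_target.mem_nhds (Ψ.map_source hΨ)] with Z hZ
    exact Ψ.right_inv hZ

end JTilde

variable (n M) in
/-- The non-holonomic frame bundle of second order: the `1`-jets at `e₁ ∈ Fℝⁿ` of the local
isomorphisms `Fℝⁿ → FM` over the identity of `GL(n, ℝ)`. -/
def SecondFrame := {a : Jet n (Rn n) M // a.src = FrameBundle.e₁ n}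

/-- The projection of the second-order frames to `M`. -/
def SecondFrame.base (Z : SecondFrame n M) : M := Z.1.tgt.base

/-- For a family `P` of second-order frames, `calG P (x, y)` is the class of `P(y) ∘ P(x)⁻¹`. -/
def calG (P : M → SecondFrame n M) (p : M × M) : JTilde n M :=
  JTilde.mk ((P p.2).1.comp (P p.1).1.inv
    ((P p.1).2.trans (P p.2).2.symm))

section Smooth
variable {E H S : Type*} [NormedAddCommGroup E] [NormedSpace ℝ E] [TopologicalSpace H]
  [TopologicalSpace S] [ChartedSpace H S]

/-- Smoothness at `s₀` of a family of `1`-jets with values in the manifold of linear maps between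
tangent spaces of `FM` and of `FN`: the source, the target and the tangent map, read in the
trivializations of the tangent bundles around `s₀`, are smooth. The spaces of jets are embedded
submanifolds of that manifold. -/
def Jet.SmoothAt (I : ModelWithCorners ℝ E H) (f : S → Jet n M N) (s₀ : S) : Prop :=
  ContMDiffAt I (modelFM n) ∞ (fun s => (f s).src) s₀ ∧
  ContMDiffAt I (modelFM n) ∞ (fun s => (f s).tgt) s₀ ∧
  ContMDiffAt I 𝓘(ℝ, modelTFM n →L[ℝ] modelTFM n) ∞
    (inTangentCoordinates (modelFM n) (modelFM n) (fun s => (f s).src) (fun s => (f s).tgt)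
      (fun s => (f s).1.deriv) s₀) s₀

/-- Smoothness of a map `F` into the quotient manifold `J̃¹(FM)`. Because the projection
`J¹(FM) → J̃¹(FM)` is a surjective submersion, `F` is smooth if and only if it lifts locally to
smooth maps into `J¹(FM)`. -/
def JTilde.Smooth (I : ModelWithCorners ℝ E H) (F : S → JTilde n M) : Prop :=
  ∀ s₀, ∃ U : Set S, IsOpen U ∧ s₀ ∈ U ∧ ∃ f : S → Jet n M M,
    ∀ s ∈ U, JTilde.mk (f s) = F s ∧ Jet.SmoothAt I f s

end Smooth

/-- Smooth sections of the bundle of second-order frames. -/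
structure SecondFrame.IsSection (P : M → SecondFrame n M) : Prop where
  base_eq : ∀ x, (P x).base = x
  smooth : ∀ x, Jet.SmoothAt (𝓡 n) (fun y => (P y).1) x

/-- Sections of `(src, tgt) : J̃¹(FM) → M × M`. Smoothness is not part of this definition. -/
structure JTilde.IsSection (Q : M × M → JTilde n M) : Prop where
  src_eq : ∀ x y, (Q (x, y)).src = x
  tgt_eq : ∀ x y, (Q (x, y)).tgt = y

end

/-!
Two second-order frames start at the same point `e₁` of `Fℝⁿ`, so for a smooth section `P` the jets
`P(y) ∘ P(x)⁻¹` compose like the pairs `(x, y)`, and they depend smoothly on `(x, y)` because the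
coordinate expression of the tangent map of a composite or of an inverse of jets is the composite or
the inverse of the coordinate expressions (`PreJet.coord_comp`, `PreJet.coord_inv`).

Conversely, let `Q` be a smooth morphism from the pair groupoid. Choose a point `x₀` and a
second-order frame `Z` over it; one exists since the charts of `Fℝⁿ` and of `FM` are equivariant, so
that a translation between them is a local isomorphism (`LocalFrameIso.ofCharts`). The group
`GL(n, ℝ)` acts freely on the frames at `x₀`, so `Q (x₀, y)` has exactly one representative `a y`
that starts at the target of `Z`. The section is `P(y) = a y ∘ Z`. The identity
`Q (x₀, y) = Q (x, y) · Q (x₀, x)` shows that `a y ∘ (a x)⁻¹` represents `Q (x, y)`, which is thus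
the class of `P(y) ∘ P(x)⁻¹`.

The smoothness of `P` is that of `a`. By hypothesis `y ↦ Q (x₀, y)` has smooth local lifts `f` to
`J¹(FM)`, and `a y = f y · g y` for a unique `g y ∈ GL(n, ℝ)`. In a chart of `FM` the action of
`GL(n, ℝ)` is the composition of linear maps (`FrameBundle.extChartAt_act`). Hence `g` is smooth,
being determined by the source of `f` (`FrameBundle.contMDiffAt_of_act_eq_const`), and so is
`f · g`, whose tangent map is that of `f` conjugated by tangent maps of the action
(`LocalFrameIso.jetAt_eq_conj`, `Jet.SmoothAt.of_mk_eq`).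
-/

/-! ### Charts of the frame bundle and of the spaces of jets -/

section Coordinates

variable {n : ℕ}
variable {M : Type*} [TopologicalSpace M] [ChartedSpace (Rn n) M] [IsManifold (𝓡 n) ∞ M]
variable {N : Type*} [TopologicalSpace N] [ChartedSpace (Rn n) N] [IsManifold (𝓡 n) ∞ N]
variable {P : Type*} [TopologicalSpace P] [ChartedSpace (Rn n) P] [IsManifold (𝓡 n) ∞ P]
variable {E H S : Type*} [NormedAddCommGroup E] [NormedSpace ℝ E] [TopologicalSpace H]
  [TopologicalSpace S] [ChartedSpace H S] {I : ModelWithCorners ℝ E H}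

namespace FrameBundle

theorem chartAt_apply (X₀ X : FrameBundle n M) :
    chartAt (ModelProd (Rn n) (Rn n →L[ℝ] Rn n)) X₀ X =
      (chartAt (Rn n) X₀.base X.base,
        ContinuousLinearMap.inCoordinates (Rn n) (Bundle.Trivial M (Rn n)) (Rn n)
          (TangentSpace (𝓡 n)) X₀.base X.base X₀.base X.base X.frame) := by
  change chartAt (ModelProd (Rn n) (Rn n →L[ℝ] Rn n)) X₀.1 X.1 = _
  rw [FiberBundle.chartedSpace_chartAt]
  rfl

theorem mem_chartAt_source (X₀ X : FrameBundle n M) :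
    X ∈ (chartAt (ModelProd (Rn n) (Rn n →L[ℝ] Rn n)) X₀).source ↔
      X.base ∈ (chartAt (Rn n) X₀.base).source := by
  have h : (chartAt (ModelProd (Rn n) (Rn n →L[ℝ] Rn n)) X₀).source =
      Subtype.val ⁻¹' (chartAt (ModelProd (Rn n) (Rn n →L[ℝ] Rn n)) X₀.1).source := by
    change (((chartAt (ModelProd (Rn n) (Rn n →L[ℝ] Rn n)) X₀.1).subtypeRestr
      ⟨(X₀ : frameOpens n M)⟩)).source = _
    exact OpenPartialHomeomorph.subtypeRestr_source _ _
  rw [h, FiberBundle.chartedSpace_chartAt]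
  constructor
  · rintro ⟨-, h2⟩
    exact h2.1
  · intro h1
    exact ⟨⟨trivial, h1⟩, h1, trivial⟩

/-- Frames are multiplied by `GL(n, ℝ)` from the right, so in a chart of `FM` the action is linear:
it composes the second coordinate with the group element. -/
theorem extChartAt_act (X₀ X : FrameBundle n M) (g : GLn n) :
    extChartAt (modelFM n) X₀ (X.act g) =
      ((extChartAt (modelFM n) X₀ X).1,
        (extChartAt (modelFM n) X₀ X).2 ∘L (g : Rn n →L[ℝ] Rn n)) := by
  change (chartAt (ModelProd (Rn n) (Rn n →L[ℝ] Rn n)) X₀ (X.act g)) =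
    ((chartAt (ModelProd (Rn n) (Rn n →L[ℝ] Rn n)) X₀ X).1,
      ((chartAt (ModelProd (Rn n) (Rn n →L[ℝ] Rn n)) X₀ X).2 ∘L (g : Rn n →L[ℝ] Rn n)))
  rw [chartAt_apply, chartAt_apply]
  refine congrArg (Prod.mk _) ?_
  ext v
  simp [ContinuousLinearMap.inCoordinates, act]
  rfl

/-- The second coordinate of a frame in a chart of `FM` is an isomorphism. -/
theorem isInvertible_extChartAt (X₀ X : FrameBundle n M)
    (h : X.base ∈ (chartAt (Rn n) X₀.base).source) :
    (extChartAt (modelFM n) X₀ X).2.IsInvertible := by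
  have h1 := ContinuousLinearMap.inCoordinates_eq (F := Rn n) (E := Bundle.Trivial M (Rn n))
    (F' := Rn n) (E' := fun x : M => TangentSpace (𝓡 n) x) (x₀ := X₀.base) (y₀ := X₀.base)
    (ϕ := X.frame) (x := X.base) (y := X.base) trivial h
  have h2 : (extChartAt (modelFM n) X₀ X).2 = _ :=
    (congrArg Prod.snd (chartAt_apply X₀ X)).trans h1
  rw [h2]
  erw [ContinuousLinearMap.isInvertible_equiv_comp, ContinuousLinearMap.isInvertible_comp_equiv]
  exact X.2

/-- The action of `GL(n, ℝ)` on the frame bundle is smooth in both variables. -/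
theorem contMDiffAt_act {X : S → FrameBundle n M} {g : S → GLn n} {s₀ : S}
    (hX : ContMDiffAt I (modelFM n) ∞ X s₀)
    (hg : ContMDiffAt I 𝓘(ℝ, Rn n →L[ℝ] Rn n) ∞ (fun s => (g s : Rn n →L[ℝ] Rn n)) s₀) :
    ContMDiffAt I (modelFM n) ∞ (fun s => (X s).act (g s)) s₀ := by
  set e := extChartAt (modelFM n) (X s₀)
  have hc : ContMDiffAt I 𝓘(ℝ, modelTFM n) ∞ (fun s => e (X s)) s₀ :=
    contMDiffAt_extChartAt.comp s₀ hX
  have hc1 : ContMDiffAt I 𝓘(ℝ, Rn n) ∞ (fun s => (e (X s)).1) s₀ :=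
    (contDiff_fst (𝕜 := ℝ) (E := Rn n) (F := Rn n →L[ℝ] Rn n)).contMDiff.contMDiffAt.comp s₀ hc
  have hc2 : ContMDiffAt I 𝓘(ℝ, Rn n →L[ℝ] Rn n) ∞ (fun s => (e (X s)).2) s₀ :=
    (contDiff_snd (𝕜 := ℝ) (E := Rn n) (F := Rn n →L[ℝ] Rn n)).contMDiff.contMDiffAt.comp s₀ hc
  have hd : ContMDiffAt I 𝓘(ℝ, modelTFM n) ∞
      (fun s => ((e (X s)).1, (e (X s)).2 ∘L (g s : Rn n →L[ℝ] Rn n))) s₀ :=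
    hc1.prodMk_space (hc2.clm_comp hg)
  have hsrc : ∀ Y : FrameBundle n M, Y ∈ e.source → ∀ k : GLn n, Y.act k ∈ e.source := by
    intro Y hY k
    rw [extChartAt_source, mem_chartAt_source] at hY ⊢
    exact hY
  have heq : (fun s => (X s).act (g s)) =ᶠ[𝓝 s₀]
      fun s => e.symm ((e (X s)).1, (e (X s)).2 ∘L (g s : Rn n →L[ℝ] Rn n)) := by
    filter_upwards [hX.continuousAt (extChartAt_source_mem_nhds (I := modelFM n) (X s₀))] with s hs
    rw [← extChartAt_act]
    exact (e.left_inv (hsrc _ hs _)).symm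
  refine ContMDiffAt.congr_of_eventuallyEq ?_ heq
  refine ContMDiffAt.comp s₀ (I' := 𝓘(ℝ, modelTFM n)) ?_ hd
  have ht : ((e (X s₀)).1, (e (X s₀)).2 ∘L (g s₀ : Rn n →L[ℝ] Rn n)) ∈ e.target := by
    rw [← extChartAt_act]
    exact e.map_source (hsrc _ (mem_extChartAt_source (I := modelFM n) (X s₀)) _)
  exact (contMDiffOn_extChartAt_symm (X s₀)).contMDiffAt
    ((isOpen_extChartAt_target (X s₀)).mem_nhds ht)

/-- If the frames `X s` and `(X s) · (g s) = X₀` depend smoothly on `s`, then so does `g`. -/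
theorem contMDiffAt_of_act_eq_const {X : S → FrameBundle n M} {g : S → GLn n}
    {X₀ : FrameBundle n M} {s₀ : S} (hX : ContMDiffAt I (modelFM n) ∞ X s₀)
    (h : ∀ᶠ s in 𝓝 s₀, (X s).act (g s) = X₀) :
    ContMDiffAt I 𝓘(ℝ, Rn n →L[ℝ] Rn n) ∞ (fun s => (g s : Rn n →L[ℝ] Rn n)) s₀ := by
  set e := extChartAt (modelFM n) (X s₀)
  have hc : ContMDiffAt I 𝓘(ℝ, modelTFM n) ∞ (fun s => e (X s)) s₀ :=
    contMDiffAt_extChartAt.comp s₀ hX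
  have hc2 : ContMDiffAt I 𝓘(ℝ, Rn n →L[ℝ] Rn n) ∞ (fun s => (e (X s)).2) s₀ :=
    (contDiff_snd (𝕜 := ℝ) (E := Rn n) (F := Rn n →L[ℝ] Rn n)).contMDiff.contMDiffAt.comp s₀ hc
  have hinv := (isInvertible_extChartAt (X s₀) (X s₀) (mem_chart_source _ _)).contDiffAt_map_inverse
    (n := ∞)
  have hd := (hinv.contMDiffAt.comp s₀ hc2).clm_comp (contMDiffAt_const (c := (e X₀).2))
  refine hd.congr_of_eventuallyEq ?_
  filter_upwards [h, hX.continuousAt (extChartAt_source_mem_nhds (I := modelFM n) (X s₀))]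
    with s hs hs'
  rw [Set.mem_preimage, extChartAt_source, mem_chartAt_source] at hs'
  obtain ⟨u, hu⟩ := isInvertible_extChartAt (X s₀) (X s) hs'
  rw [← hs, extChartAt_act]
  change _ = ContinuousLinearMap.inverse (e (X s)).2 ∘L ((e (X s)).2 ∘L _)
  rw [← hu, ContinuousLinearMap.inverse_equiv]
  ext1 v
  simp

end FrameBundle

namespace PreJet

/-- The tangent map of a `1`-jet, read in the trivializations of the tangent bundles around the
frames `X₀` and `Y₀`. -/
noncomputable def coord (X₀ : FrameBundle n M) (Y₀ : FrameBundle n N) (a : PreJet n M N) :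
    modelTFM n →L[ℝ] modelTFM n :=
  ContinuousLinearMap.inCoordinates (modelTFM n)
    (fun X : FrameBundle n M => TangentSpace (modelFM n) X) (modelTFM n)
    (fun Y : FrameBundle n N => TangentSpace (modelFM n) Y) X₀ a.src Y₀ a.tgt a.deriv

theorem coord_comp {X₀ : FrameBundle n M} {Y₀ : FrameBundle n N} {Z₀ : FrameBundle n P}
    (b : PreJet n N P) (a : PreJet n M N) (h : a.tgt = b.src)
    (hX : a.src ∈ (chartAt (ModelProd (Rn n) (Rn n →L[ℝ] Rn n)) X₀).source)
    (hY : a.tgt ∈ (chartAt (ModelProd (Rn n) (Rn n →L[ℝ] Rn n)) Y₀).source)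
    (hZ : b.tgt ∈ (chartAt (ModelProd (Rn n) (Rn n →L[ℝ] Rn n)) Z₀).source) :
    (b.comp a h).coord X₀ Z₀ = b.coord Y₀ Z₀ ∘L a.coord X₀ Y₀ := by
  obtain ⟨X, Y, L⟩ := a
  obtain ⟨Y', Z, L'⟩ := b
  obtain rfl : Y = Y' := h
  simp only [coord, comp]
  rw [ContinuousLinearMap.inCoordinates_eq (x₀ := X₀) (x := X) (y₀ := Z₀) (y := Z) hX hZ,
    ContinuousLinearMap.inCoordinates_eq (x₀ := X₀) (x := X) (y₀ := Y₀) (y := Y) hX hY,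
    ContinuousLinearMap.inCoordinates_eq (x₀ := Y₀) (x := Y) (y₀ := Z₀) (y := Z) hY hZ]
  refine ContinuousLinearMap.ext fun v => ?_
  simp

theorem coord_inv {X₀ : FrameBundle n M} {Y₀ : FrameBundle n N} (a : PreJet n M N)
    (hX : a.src ∈ (chartAt (ModelProd (Rn n) (Rn n →L[ℝ] Rn n)) X₀).source)
    (hY : a.tgt ∈ (chartAt (ModelProd (Rn n) (Rn n →L[ℝ] Rn n)) Y₀).source) :
    a.inv.coord Y₀ X₀ = (a.coord X₀ Y₀).inverse := by
  simp only [coord, inv]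
  rw [ContinuousLinearMap.inCoordinates_eq (x₀ := X₀) (x := a.src) (y₀ := Y₀) (y := a.tgt) hX hY,
    ContinuousLinearMap.inCoordinates_eq (x₀ := Y₀) (x := a.tgt) (y₀ := X₀) (y := a.src) hY hX,
    ContinuousLinearMap.inverse_equiv_comp, ContinuousLinearMap.inverse_comp_equiv]
  simp
  rfl

theorem isInvertible_coord {X₀ : FrameBundle n M} {Y₀ : FrameBundle n N} (a : PreJet n M N)
    (ha : a.deriv.IsInvertible)
    (hX : a.src ∈ (chartAt (ModelProd (Rn n) (Rn n →L[ℝ] Rn n)) X₀).source)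
    (hY : a.tgt ∈ (chartAt (ModelProd (Rn n) (Rn n →L[ℝ] Rn n)) Y₀).source) :
    (a.coord X₀ Y₀).IsInvertible := by
  simp only [coord]
  rw [ContinuousLinearMap.inCoordinates_eq (x₀ := X₀) (x := a.src) (y₀ := Y₀) (y := a.tgt) hX hY,
    ContinuousLinearMap.isInvertible_equiv_comp, ContinuousLinearMap.isInvertible_comp_equiv]
  exact ha

end PreJet

end Coordinates

/-! ### Smooth families of jets -/

section Smoothness

variable {n : ℕ}
variable {M : Type*} [TopologicalSpace M] [ChartedSpace (Rn n) M] [IsManifold (𝓡 n) ∞ M]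
variable {N : Type*} [TopologicalSpace N] [ChartedSpace (Rn n) N] [IsManifold (𝓡 n) ∞ N]
variable {P : Type*} [TopologicalSpace P] [ChartedSpace (Rn n) P] [IsManifold (𝓡 n) ∞ P]
variable {E H S : Type*} [NormedAddCommGroup E] [NormedSpace ℝ E] [TopologicalSpace H]
  [TopologicalSpace S] [ChartedSpace H S] {I : ModelWithCorners ℝ E H}
variable {E' H' T : Type*} [NormedAddCommGroup E'] [NormedSpace ℝ E'] [TopologicalSpace H']
  [TopologicalSpace T] [ChartedSpace H' T] {I' : ModelWithCorners ℝ E' H'}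

namespace PreJet

/-- Smoothness at `s₀` of a family of triples `(X, Y, L)` with `L : T_X FM → T_Y FN` linear. For
families of jets this is `Jet.SmoothAt`; the weaker type allows the tangent maps of the action of
`GL(n, ℝ)`, which are not jets of local isomorphisms. -/
structure SmoothAt (I : ModelWithCorners ℝ E H) (f : S → PreJet n M N) (s₀ : S) : Prop where
  src : ContMDiffAt I (modelFM n) ∞ (fun s => (f s).src) s₀
  tgt : ContMDiffAt I (modelFM n) ∞ (fun s => (f s).tgt) s₀
  coord : ContMDiffAt I 𝓘(ℝ, modelTFM n →L[ℝ] modelTFM n) ∞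
    (fun s => (f s).coord (f s₀).src (f s₀).tgt) s₀

namespace SmoothAt

variable {f : S → PreJet n M N} {s₀ : S}

theorem eventually_src_mem (hf : SmoothAt I f s₀) : ∀ᶠ s in 𝓝 s₀,
    (f s).src ∈ (chartAt (ModelProd (Rn n) (Rn n →L[ℝ] Rn n)) (f s₀).src).source :=
  hf.src.continuousAt (chart_source_mem_nhds _ _)

theorem eventually_tgt_mem (hf : SmoothAt I f s₀) : ∀ᶠ s in 𝓝 s₀,
    (f s).tgt ∈ (chartAt (ModelProd (Rn n) (Rn n →L[ℝ] Rn n)) (f s₀).tgt).source :=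
  hf.tgt.continuousAt (chart_source_mem_nhds _ _)

theorem congr (hf : SmoothAt I f s₀) {f' : S → PreJet n M N} (h : f' =ᶠ[𝓝 s₀] f) :
    SmoothAt I f' s₀ := by
  refine ⟨hf.src.congr_of_eventuallyEq ?_, hf.tgt.congr_of_eventuallyEq ?_,
    hf.coord.congr_of_eventuallyEq ?_⟩
  · filter_upwards [h] with s hs
    rw [hs]
  · filter_upwards [h] with s hs
    rw [hs]
  · filter_upwards [h] with s hs
    rw [hs, h.eq_of_nhds]

theorem comp_contMDiffAt {h : T → S} {t₀ : T} (hf : SmoothAt I f (h t₀))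
    (hh : ContMDiffAt I' I ∞ h t₀) : SmoothAt I' (fun t => f (h t)) t₀ :=
  ⟨hf.src.comp t₀ hh, hf.tgt.comp t₀ hh, hf.coord.comp t₀ hh⟩

theorem const (a : PreJet n M N) : SmoothAt I (fun _ : S => a) s₀ :=
  ⟨contMDiffAt_const, contMDiffAt_const, contMDiffAt_const⟩

theorem comp {g : S → PreJet n N P} (hg : SmoothAt I g s₀) (hf : SmoothAt I f s₀)
    (h : ∀ s, (f s).tgt = (g s).src) : SmoothAt I (fun s => (g s).comp (f s) (h s)) s₀ := by
  refine ⟨hf.src, hg.tgt, ?_⟩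
  have hg' := hg.coord
  rw [← h s₀] at hg'
  refine (hg'.clm_comp hf.coord).congr_of_eventuallyEq ?_
  filter_upwards [hf.eventually_src_mem, hf.eventually_tgt_mem, hg.eventually_tgt_mem]
    with s h1 h2 h3
  exact coord_comp (g s) (f s) (h s) h1 h2 h3

theorem inv (hf : SmoothAt I f s₀) (h : (f s₀).deriv.IsInvertible) :
    SmoothAt I (fun s => (f s).inv) s₀ := by
  refine ⟨hf.tgt, hf.src, ?_⟩
  have hinv := ((f s₀).isInvertible_coord h (mem_chart_source _ _)
    (mem_chart_source _ _)).contDiffAt_map_inverse (n := ∞)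
  refine (hinv.contMDiffAt.comp s₀ hf.coord).congr_of_eventuallyEq ?_
  filter_upwards [hf.eventually_src_mem, hf.eventually_tgt_mem] with s h1 h2
  exact coord_inv (f s) h1 h2

end SmoothAt

/-- The tangent map at `X` of the action of `g ∈ GL(n, ℝ)` on `FM`. -/
noncomputable def ofAct (g : GLn n) (X : FrameBundle n M) : PreJet n M M :=
  ⟨X, X.act g, mfderiv (modelFM n) (modelFM n) (fun W : FrameBundle n M => W.act g) X⟩

theorem smoothAt_ofAct [IsManifold I 1 S] {g : S → GLn n} {X : S → FrameBundle n M} {s₀ : S}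
    (hg : ContMDiffAt I 𝓘(ℝ, Rn n →L[ℝ] Rn n) ∞ (fun s => (g s : Rn n →L[ℝ] Rn n)) s₀)
    (hX : ContMDiffAt I (modelFM n) ∞ X s₀) : SmoothAt I (fun s => ofAct (g s) (X s)) s₀ := by
  refine ⟨hX, FrameBundle.contMDiffAt_act hX hg, ?_⟩
  refine ContMDiffAt.mfderiv (n := ∞) (fun s (W : FrameBundle n M) => W.act (g s)) X ?_ hX le_rfl
  exact FrameBundle.contMDiffAt_act (g := fun p : S × FrameBundle n M => g p.1) contMDiffAt_snd
    (ContMDiffAt.comp (s₀, X s₀) (g := fun s => (g s : Rn n →L[ℝ] Rn n)) hg contMDiffAt_fst)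

end PreJet

/-- By equivariance, the jet of `Ψ` at `X · g` is the jet of `Ψ` at `X` conjugated by the action
of `g`. -/
theorem LocalFrameIso.jetAt_eq_conj (Ψ : LocalFrameIso n M N) (g : GLn n) (Y : FrameBundle n M)
    (hY : Y.act g⁻¹ ∈ Ψ.source) :
    Ψ.jetAt Y = (PreJet.ofAct g (Ψ (Y.act g⁻¹))).comp
      ((Ψ.jetAt (Y.act g⁻¹)).comp (PreJet.ofAct g⁻¹ Y) rfl) rfl := by
  have hYg : (Y.act g⁻¹).act g = Y := by
    rw [FrameBundle.act_act, inv_mul_cancel, FrameBundle.act_one]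
  have h := Ψ.eventuallyEq_conj hY g
  rw [hYg] at h
  refine PreJet.ext_of rfl h.eq_of_nhds ?_
  have h1 := FrameBundle.mdifferentiableAt_act g⁻¹ Y
  have h2 := Ψ.mdifferentiableAt hY
  have h3 := FrameBundle.mdifferentiableAt_act g (Ψ (Y.act g⁻¹))
  refine (h.mfderiv_eq (I := modelFM n) (I' := modelFM n)).trans ?_
  refine (mfderiv_comp Y h3 (h2.comp Y h1)).trans ?_
  exact congrArg (fun L : modelTFM n →L[ℝ] modelTFM n =>
    (PreJet.ofAct g (Ψ (Y.act g⁻¹))).deriv ∘L L) (mfderiv_comp Y h2 h1)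

namespace Jet

theorem isInvertible_deriv (a : Jet n M N) : a.1.deriv.IsInvertible := by
  obtain ⟨Ψ, X, hX, rfl⟩ := a.exists_of
  have h1 := Ψ.deriv_symm_comp hX
  have h2 := Ψ.symm.deriv_symm_comp (X := Ψ X) (Ψ.map_source hX)
  have hX' : Ψ.symm (Ψ X) = X := Ψ.left_inv hX
  rw [hX'] at h2
  exact ContinuousLinearMap.IsInvertible.of_inverse h2 h1

theorem smoothAt_iff {f : S → Jet n M N} {s₀ : S} :
    Jet.SmoothAt I f s₀ ↔ PreJet.SmoothAt I (fun s => (f s).1) s₀ :=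
  ⟨fun h => ⟨h.1, h.2.1, h.2.2⟩, fun h => ⟨h.1, h.2, h.3⟩⟩

theorem SmoothAt.comp {f : S → Jet n M N} {g : S → Jet n N P} {s₀ : S}
    (hg : Jet.SmoothAt I g s₀) (hf : Jet.SmoothAt I f s₀) (h : ∀ s, (f s).tgt = (g s).src) :
    Jet.SmoothAt I (fun s => (g s).comp (f s) (h s)) s₀ :=
  smoothAt_iff.2 ((smoothAt_iff.1 hg).comp (smoothAt_iff.1 hf) h)

theorem SmoothAt.inv {f : S → Jet n M N} {s₀ : S} (hf : Jet.SmoothAt I f s₀) :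
    Jet.SmoothAt I (fun s => (f s).inv) s₀ :=
  smoothAt_iff.2 ((smoothAt_iff.1 hf).inv (f s₀).isInvertible_deriv)

theorem SmoothAt.comp_contMDiffAt {f : S → Jet n M N} {h : T → S} {t₀ : T}
    (hf : Jet.SmoothAt I f (h t₀)) (hh : ContMDiffAt I' I ∞ h t₀) :
    Jet.SmoothAt I' (fun t => f (h t)) t₀ :=
  smoothAt_iff.2 ((smoothAt_iff.1 hf).comp_contMDiffAt hh)

theorem smoothAt_const (a : Jet n M N) {s₀ : S} : Jet.SmoothAt I (fun _ : S => a) s₀ :=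
  smoothAt_iff.2 (.const a.1)

/-- A lift to `J¹(FM)` of a smooth family in `J̃¹(FM)` is smooth as soon as its source is a constant
frame: the group elements that move a smooth local lift to it are smooth, since they are determined
by the sources. -/
theorem SmoothAt.of_mk_eq [IsManifold I 1 S] {f f' : S → Jet n M M} {s₀ : S}
    {X₀ : FrameBundle n M} (hf : Jet.SmoothAt I f s₀) (hX₀ : ∀ s, (f' s).src = X₀)
    (h : ∀ᶠ s in 𝓝 s₀, JTilde.mk (f s) = JTilde.mk (f' s)) : Jet.SmoothAt I f' s₀ := by
  -- The composition of families needs a group element for every `s`; its value is arbitrary where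
  -- the two classes differ.
  have hex : ∀ s, ∃ g : GLn n, JTilde.mk (f s) = JTilde.mk (f' s) →
      ∃ (Ψ : LocalFrameIso n M M) (X : FrameBundle n M) (hX : X ∈ Ψ.source),
        f s = of Ψ X hX ∧ f' s = of Ψ (X.act g) (Ψ.act_mem_source X g hX) := by
    intro s
    by_cases hs : JTilde.mk (f s) = JTilde.mk (f' s)
    · obtain ⟨Ψ, X, hX, g, h1, h2⟩ : (orbitSetoid n M).r (f s) (f' s) := Quotient.exact hs
      exact ⟨g, fun _ => ⟨Ψ, X, hX, h1, h2⟩⟩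
    · exact ⟨1, fun h => absurd h hs⟩
  choose g hg using hex
  have hact : ∀ᶠ s in 𝓝 s₀, (f s).src.act (g s) = X₀ := by
    filter_upwards [h] with s hs
    obtain ⟨Ψ, X, hX, h1, h2⟩ := hg s hs
    rw [← hX₀ s, h1, h2]
    rfl
  have hf' := smoothAt_iff.1 hf
  have hgs := FrameBundle.contMDiffAt_of_act_eq_const hf'.src hact
  have hgi : ContMDiffAt I 𝓘(ℝ, Rn n →L[ℝ] Rn n) ∞
      (fun s => (((g s)⁻¹ : GLn n) : Rn n →L[ℝ] Rn n)) s₀ := by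
    refine ((contDiffAt_map_inverse (n := ∞) (g s₀)).contMDiffAt.comp s₀ hgs).congr_of_eventuallyEq
      (.of_forall fun s => ?_)
    exact (ContinuousLinearMap.inverse_equiv (g s)).symm
  have hR := PreJet.smoothAt_ofAct hgs hf'.tgt
  have hL := PreJet.smoothAt_ofAct hgi (FrameBundle.contMDiffAt_act hf'.src hgs)
  have hconj := hR.comp (hf'.comp hL fun s => (f s).src.act_act_inv (g s)) fun _ => rfl
  refine smoothAt_iff.2 (hconj.congr ?_)
  filter_upwards [h] with s hs
  obtain ⟨Ψ, X, hX, h1, h2⟩ := hg s hs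
  have hX' : (X.act (g s)).act (g s)⁻¹ = X := X.act_act_inv (g s)
  -- Stated for a variable `Y`, so that substitution removes the cast along `hY` in `PreJet.comp`.
  have key : ∀ (Y : FrameBundle n M) (hY : (X.act (g s)).act (g s)⁻¹ = Y) (hY' : Y ∈ Ψ.source),
      Ψ.jetAt (X.act (g s)) = (PreJet.ofAct (g s) (Ψ Y)).comp
        ((Ψ.jetAt Y).comp (PreJet.ofAct (g s)⁻¹ (X.act (g s))) hY) rfl := by
    rintro _ rfl hY'
    exact Ψ.jetAt_eq_conj (g s) _ hY'
  rw [h2]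
  simp only [h1]
  exact key X hX' hX

end Jet

end Smoothness

/-! ### Existence of second-order frames -/

section Existence

variable {n : ℕ}
variable {M : Type*} [TopologicalSpace M] [ChartedSpace (Rn n) M] [IsManifold (𝓡 n) ∞ M]
variable {N : Type*} [TopologicalSpace N] [ChartedSpace (Rn n) N] [IsManifold (𝓡 n) ∞ N]

namespace LocalFrameIso

/-- The map `FM → FN` that in the charts around `X₀` and `X₁` is the translation
`(v, L) ↦ (v + c, L)`. -/
noncomputable def chartTranslation (X₀ : FrameBundle n M) (X₁ : FrameBundle n N) (c : Rn n) :
    OpenPartialHomeomorph (FrameBundle n M) (FrameBundle n N) :=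
  ((chartAt (ModelProd (Rn n) (Rn n →L[ℝ] Rn n)) X₀).trans
    (show OpenPartialHomeomorph (ModelProd (Rn n) (Rn n →L[ℝ] Rn n))
        (ModelProd (Rn n) (Rn n →L[ℝ] Rn n)) from
      (Homeomorph.addRight ((c, 0) : modelTFM n)).toOpenPartialHomeomorph)).trans
    (chartAt (ModelProd (Rn n) (Rn n →L[ℝ] Rn n)) X₁).symm

variable (X₀ : FrameBundle n M) (X₁ : FrameBundle n N) (c : Rn n)

theorem mem_chartTranslation_source {X : FrameBundle n M} :
    X ∈ (chartTranslation X₀ X₁ c).source ↔ X ∈ (extChartAt (modelFM n) X₀).source ∧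
      extChartAt (modelFM n) X₀ X + (c, 0) ∈ (extChartAt (modelFM n) X₁).target := by
  rw [extChartAt_source, extChartAt_target]
  change (_ ∧ True) ∧ _ ↔ _ ∧ _ ∧ _ ∈ Set.range _
  rw [(modelFM n).range_eq_univ]
  simp only [and_true, Set.mem_univ]
  exact Iff.rfl

theorem chartTranslation_apply (X : FrameBundle n M) :
    chartTranslation X₀ X₁ c X =
      (extChartAt (modelFM n) X₁).symm (extChartAt (modelFM n) X₀ X + (c, 0)) := rfl

theorem chartTranslation_symm :
    (chartTranslation X₀ X₁ c).symm = chartTranslation X₁ X₀ (-c) := by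
  have h : (Homeomorph.addRight ((c, 0) : modelTFM n)).symm = Homeomorph.addRight (-c, 0) := by
    ext1 v
    change v + -(c, 0) = v + (-c, 0)
    rw [Prod.neg_mk, neg_zero]
  have h' := congrArg Homeomorph.toOpenPartialHomeomorph h
  rw [Homeomorph.symm_toOpenPartialHomeomorph] at h'
  simp only [chartTranslation]
  rw [OpenPartialHomeomorph.trans_symm_eq_symm_trans_symm,
    OpenPartialHomeomorph.trans_symm_eq_symm_trans_symm, OpenPartialHomeomorph.symm_symm,
    OpenPartialHomeomorph.trans_assoc]
  exact congrArg (fun e : OpenPartialHomeomorph (ModelProd (Rn n) (Rn n →L[ℝ] Rn n))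
    (ModelProd (Rn n) (Rn n →L[ℝ] Rn n)) => (chartAt _ X₁).trans (e.trans (chartAt _ X₀).symm)) h'

theorem chartTranslation_act {X : FrameBundle n M} (hX : X ∈ (chartTranslation X₀ X₁ c).source)
    (g : GLn n) : X.act g ∈ (chartTranslation X₀ X₁ c).source ∧
      chartTranslation X₀ X₁ c (X.act g) = (chartTranslation X₀ X₁ c X).act g := by
  rw [mem_chartTranslation_source] at hX ⊢
  rw [chartTranslation_apply, chartTranslation_apply]
  -- `Y` is the image of `X`, known only through its coordinates.
  obtain ⟨Y, hY, hYX⟩ : ∃ Y ∈ (extChartAt (modelFM n) X₁).source,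
      extChartAt (modelFM n) X₁ Y = extChartAt (modelFM n) X₀ X + (c, 0) :=
    ⟨_, (extChartAt (modelFM n) X₁).map_target hX.2, (extChartAt (modelFM n) X₁).right_inv hX.2⟩
  have hYg : Y.act g ∈ (extChartAt (modelFM n) X₁).source := by
    rw [extChartAt_source, FrameBundle.mem_chartAt_source] at hY ⊢
    exact hY
  have key : extChartAt (modelFM n) X₀ (X.act g) + (c, 0) =
      extChartAt (modelFM n) X₁ (Y.act g) := by
    rw [FrameBundle.extChartAt_act, FrameBundle.extChartAt_act, hYX, Prod.mk_add_mk, Prod.fst_add,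
      Prod.snd_add, add_zero, add_zero]
  rw [key, ← hYX, (extChartAt (modelFM n) X₁).left_inv hY,
    (extChartAt (modelFM n) X₁).left_inv hYg]
  refine ⟨⟨?_, (extChartAt (modelFM n) X₁).map_source hYg⟩, rfl⟩
  have hX' := hX.1
  rw [extChartAt_source, FrameBundle.mem_chartAt_source] at hX' ⊢
  exact hX'

theorem contMDiffOn_chartTranslation : ContMDiffOn (modelFM n) (modelFM n) ∞
    (chartTranslation X₀ X₁ c) (chartTranslation X₀ X₁ c).source := by
  have h1 : ContMDiff 𝓘(ℝ, modelTFM n) 𝓘(ℝ, modelTFM n) ∞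
      (fun v : modelTFM n => v + (c, 0)) := (contDiff_id.add contDiff_const).contMDiff
  refine (contMDiffOn_extChartAt_symm X₁).comp
    (h1.comp_contMDiffOn ((contMDiffOn_extChartAt (x := X₀)).mono fun X hX => ?_)) fun X hX => ?_
  · rw [mem_chartTranslation_source, extChartAt_source] at hX
    exact hX.1
  · rw [mem_chartTranslation_source] at hX
    exact hX.2

/-- The frame bundles of two manifolds of the same dimension are locally isomorphic around any two
frames. -/
noncomputable def ofCharts : LocalFrameIso n M N where
  toOpenPartialHomeomorph := chartTranslation X₀ X₁ c
  act_mem_source _ g hX := (chartTranslation_act X₀ X₁ c hX g).1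
  map_act _ g hX := (chartTranslation_act X₀ X₁ c hX g).2
  contMDiffOn_toFun := contMDiffOn_chartTranslation X₀ X₁ c
  contMDiffOn_invFun := by
    have h := contMDiffOn_chartTranslation X₁ X₀ (-c)
    rwa [← chartTranslation_symm] at h

end LocalFrameIso

theorem SecondFrame.exists_base_eq (x : M) : ∃ Z : SecondFrame n M, Z.base = x := by
  obtain ⟨X₁, rfl⟩ := JTilde.exists_src (n := n) x
  set X₀ := FrameBundle.e₁ n
  obtain ⟨u, hu⟩ := FrameBundle.isInvertible_extChartAt X₀ X₀ (mem_chart_source _ _)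
  obtain ⟨v, hv⟩ := FrameBundle.isInvertible_extChartAt X₁ X₁ (mem_chart_source _ _)
  set c := (extChartAt (modelFM n) X₁ X₁).1 - (extChartAt (modelFM n) X₀ X₀).1
  -- The element `g` is chosen such that the frame `X₁ · g` has the same second coordinate as `e₁`.
  let g : GLn n := u.trans v.symm
  have hg : X₁.act g ∈ (extChartAt (modelFM n) X₁).source := by
    rw [extChartAt_source, FrameBundle.mem_chartAt_source]
    exact mem_chart_source _ _
  have key : extChartAt (modelFM n) X₀ X₀ + (c, 0) = extChartAt (modelFM n) X₁ (X₁.act g) := by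
    rw [FrameBundle.extChartAt_act]
    refine Prod.ext (add_sub_cancel _ _) ?_
    change (extChartAt (modelFM n) X₀ X₀).2 + (0 : Rn n →L[ℝ] Rn n) =
      (extChartAt (modelFM n) X₁ X₁).2 ∘L _
    rw [← hu, ← hv, add_zero]
    ext1 w
    exact (v.apply_symm_apply (u w)).symm
  have hX₀ : X₀ ∈ (LocalFrameIso.ofCharts X₀ X₁ c).source :=
    (LocalFrameIso.mem_chartTranslation_source X₀ X₁ c).2
      ⟨mem_extChartAt_source _, key ▸ (extChartAt (modelFM n) X₁).map_source hg⟩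
  have hΨ : LocalFrameIso.ofCharts X₀ X₁ c X₀ = X₁.act g := by
    change LocalFrameIso.chartTranslation X₀ X₁ c X₀ = _
    rw [LocalFrameIso.chartTranslation_apply, key]
    exact (extChartAt (modelFM n) X₁).left_inv hg
  refine ⟨⟨Jet.of (LocalFrameIso.ofCharts X₀ X₁ c) X₀ hX₀, rfl⟩, ?_⟩
  exact (congrArg FrameBundle.base hΨ).trans (X₁.base_act g)

end Existence

/-! ### Sections of the second-order frame bundle and morphisms from the pair groupoid -/

section Correspondence

variable {n : ℕ}
variable {M : Type*} [TopologicalSpace M] [ChartedSpace (Rn n) M] [IsManifold (𝓡 n) ∞ M]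
variable {N : Type*} [TopologicalSpace N] [ChartedSpace (Rn n) N] [IsManifold (𝓡 n) ∞ N]
variable {P : Type*} [TopologicalSpace P] [ChartedSpace (Rn n) P] [IsManifold (𝓡 n) ∞ P]

namespace Jet

/-- The identity `(c ∘ b⁻¹) ∘ (b ∘ a⁻¹) = c ∘ a⁻¹`. -/
theorem comp_inv_comp_comp_inv (c : Jet n N P) (b : Jet n N M) (a : Jet n N M)
    (hab : a.src = b.src) (hbc : b.src = c.src) :
    (c.comp b.inv hbc).comp (b.comp a.inv hab) rfl = c.comp a.inv (hab.trans hbc) := by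
  obtain ⟨⟨X, Y, L⟩, ha⟩ := a
  obtain ⟨⟨X', Y', L'⟩, hb⟩ := b
  obtain ⟨⟨X'', Y'', L''⟩, hc⟩ := c
  obtain rfl : X = X' := hab
  obtain rfl : X = X'' := hbc
  obtain ⟨u, rfl⟩ : L'.IsInvertible := isInvertible_deriv ⟨_, hb⟩
  refine Subtype.ext (PreJet.ext_of rfl rfl ?_)
  change (L'' ∘L ContinuousLinearMap.inverse u.toContinuousLinearMap) ∘L
    (u.toContinuousLinearMap ∘L L.inverse) = L'' ∘L L.inverse
  rw [ContinuousLinearMap.inverse_equiv]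
  refine ContinuousLinearMap.ext fun v => ?_
  exact congrArg L'' (u.symm_apply_apply _)

/-- The identity `(b ∘ a ∘ z) ∘ (a ∘ z)⁻¹ = b`. -/
theorem comp_comp_comp_inv (b : Jet n M P) (a : Jet n M M) (z : Jet n N M)
    (hza : z.tgt = a.src) (hab : a.tgt = b.src) :
    ((b.comp a hab).comp z hza).comp (a.comp z hza).inv rfl = b := by
  obtain ⟨⟨X, Y, L⟩, hz⟩ := z
  obtain ⟨⟨Y', Z, L'⟩, ha⟩ := a
  obtain ⟨⟨Z', W, L''⟩, hb⟩ := b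
  obtain rfl : Y = Y' := hza
  obtain rfl : Z = Z' := hab
  obtain ⟨u, rfl⟩ : L.IsInvertible := isInvertible_deriv ⟨_, hz⟩
  obtain ⟨v, rfl⟩ : L'.IsInvertible := isInvertible_deriv ⟨_, ha⟩
  refine Subtype.ext (PreJet.ext_of rfl rfl ?_)
  change ((L'' ∘L v.toContinuousLinearMap) ∘L u.toContinuousLinearMap) ∘L
    ContinuousLinearMap.inverse (u.trans v).toContinuousLinearMap = L''
  rw [ContinuousLinearMap.inverse_equiv]
  refine ContinuousLinearMap.ext fun w => ?_
  exact congrArg L'' ((u.trans v).apply_symm_apply w)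

end Jet

theorem calG_isGroupoidHom {P : M → SecondFrame n M} (hP : ∀ x, (P x).base = x) :
    IsGroupoidHom (pairGroupoid M) (JTilde.groupoid n M) (calG P) id where
  src_map p := hP p.1
  tgt_map p := hP p.2
  map_mul := by
    rintro ⟨y', z⟩ ⟨x, y⟩ h
    obtain rfl : y' = y := h
    refine ((JTilde.mul_mk ((P z).1.comp (P y').1.inv ((P y').2.trans (P z).2.symm))
      ((P y').1.comp (P x).1.inv ((P x).2.trans (P y').2.symm)) rfl rfl).trans ?_).symm
    exact congrArg JTilde.mk (Jet.comp_inv_comp_comp_inv _ _ _ ((P x).2.trans (P y').2.symm)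
      ((P y').2.trans (P z).2.symm))

theorem SecondFrame.IsSection.smooth_calG {P : M → SecondFrame n M}
    (hP : SecondFrame.IsSection P) : JTilde.Smooth ((𝓡 n).prod (𝓡 n)) (calG P) := by
  refine fun _ => ⟨Set.univ, isOpen_univ, trivial,
    fun p => (P p.2).1.comp (P p.1).1.inv ((P p.1).2.trans (P p.2).2.symm), ?_⟩
  rintro ⟨x, y⟩ -
  refine ⟨rfl, Jet.SmoothAt.comp (f := fun p : M × M => (P p.1).1.inv) (g := fun p => (P p.2).1)
    ?_ ?_ _⟩
  · exact (hP.smooth y).comp_contMDiffAt (h := fun p : M × M => p.2) (t₀ := (x, y)) contMDiffAt_snd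
  · exact (hP.smooth x).inv.comp_contMDiffAt (h := fun p : M × M => p.1) (t₀ := (x, y))
      contMDiffAt_fst

/-- The representatives of `Q (x₀, y)` that start at the target of a second-order frame `Z` at `x₀`
are uniquely determined. Their composites with `Z` form the required section. -/
theorem exists_isSection_calG_eq {Q : M × M → JTilde n M}
    (hQ : IsGroupoidHom (pairGroupoid M) (JTilde.groupoid n M) Q id)
    (hs : JTilde.Smooth ((𝓡 n).prod (𝓡 n)) Q) (x₀ : M) :
    ∃ P : M → SecondFrame n M, SecondFrame.IsSection P ∧ calG P = Q := by
  have hsrc : ∀ p, (Q p).src = p.1 := hQ.src_map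
  have htgt : ∀ p, (Q p).tgt = p.2 := hQ.tgt_map
  obtain ⟨Z, hZ⟩ := SecondFrame.exists_base_eq (n := n) x₀
  have hrep : ∀ y, ∃ a : Jet n M M, a.src = Z.1.tgt ∧ JTilde.mk a = Q (x₀, y) := by
    intro y
    obtain ⟨Ψ, hΨ, h⟩ := (Q (x₀, y)).exists_of Z.1.tgt (hZ.trans (hsrc (x₀, y)).symm)
    exact ⟨_, rfl, h.symm⟩
  choose a ha hmk using hrep
  refine ⟨fun y => ⟨(a y).comp Z.1 (ha y).symm, Z.2⟩, ⟨fun y => ?_, fun y => ?_⟩, ?_⟩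
  · exact (congrArg JTilde.tgt (hmk y)).trans (htgt _)
  · obtain ⟨U, hU, hyU, f, hf⟩ := hs (x₀, y)
    have : IsManifold (𝓡 n) 1 M := IsManifold.of_le (n := ∞) (by simp)
    have hι : ContMDiffAt (𝓡 n) ((𝓡 n).prod (𝓡 n)) ∞ (fun z : M => (x₀, z)) y :=
      contMDiffAt_const.prodMk contMDiffAt_id
    have hfa : Jet.SmoothAt (𝓡 n) a y := by
      refine ((hf _ hyU).2.comp_contMDiffAt (h := fun z : M => (x₀, z)) hι).of_mk_eq ha ?_
      filter_upwards [hι.continuousAt (hU.mem_nhds hyU)] with z hz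
      exact (hf _ hz).1.trans (hmk z).symm
    exact hfa.comp (Jet.smoothAt_const Z.1) fun z => (ha z).symm
  · funext ⟨x, y⟩
    have hax : (a x).tgt.base = x := (congrArg JTilde.tgt (hmk x)).trans (htgt _)
    obtain ⟨Ψ, hΨ, hb⟩ := (Q (x, y)).exists_of (a x).tgt (hax.trans (hsrc (x, y)).symm)
    have hmul : Q (x₀, y) = JTilde.mk ((Jet.of Ψ (a x).tgt hΨ).comp (a x) rfl) :=
      (hQ.map_mul (x, y) (x₀, x) rfl).trans (JTilde.mul_eq _ _ hb (hmk x).symm rfl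
        ((hsrc (x, y)).trans (htgt (x₀, x)).symm))
    have hay : a y = (Jet.of Ψ (a x).tgt hΨ).comp (a x) rfl :=
      JTilde.mk_eq_mk ((hmk y).trans hmul) ((ha y).trans (ha x).symm)
    rw [hb]
    refine congrArg JTilde.mk ?_
    have key := Jet.comp_comp_comp_inv (Jet.of Ψ (a x).tgt hΨ) (a x) Z.1 (ha x).symm rfl
    simp only [hay]
    exact key

end Correspondence

theorem mainTheorem7 (n : ℕ) (M : Type*) [TopologicalSpace M] [ChartedSpace (Rn n) M]
    [IsManifold (𝓡 n) ∞ M] (Q : M × M → JTilde n M) (hQ : JTilde.IsSection Q) :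
    (∃ P : M → SecondFrame n M, SecondFrame.IsSection P ∧ calG P = Q) ↔
      (IsGroupoidHom (pairGroupoid M) (JTilde.groupoid n M) Q id ∧
        JTilde.Smooth ((𝓡 n).prod (𝓡 n)) Q) := by
  constructor
  · rintro ⟨P, hP, rfl⟩
    exact ⟨calG_isGroupoidHom hP.base_eq, hP.smooth_calG⟩
  · rintro ⟨hhom, hs⟩
    rcases isEmpty_or_nonempty M with hM | ⟨⟨x₀⟩⟩
    · exact ⟨fun x => hM.elim x, ⟨fun x => hM.elim x, fun x => hM.elim x⟩,
        funext fun p => hM.elim p.1⟩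
    · exact exists_isSection_calG_eq hhom hs x₀
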